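/- A directed graph $\Gamma=(V,E,s,r)$ consists of two arbitrary sets $V$ (vertices) and $E$ (edges) and two functions $s,r:E\to V$ (source and range). The graph inverse semigroup $\mathrm{Inv}(\Gamma)$ is the semigroup with zero generated by $V$, $E$ and $E^*=\{e^*: e\in E\}$, subject to the relations, for all $u,v\in V$ and $e,f\in E$, $$uv=\delta_{u,v}u,\qquad s(e)e=e\,r(e)=e,\qquad r(e)e^*=e^*s(e)=e^*,\qquad f^*e=\delta_{f,e}\,r(e),$$ where $\delta$ is the Kronecker delta. Let $\mathscr{C}(\mathrm{Inv}(\Gamma))$ be the lattice of all congruences on $\mathrm{Inv}(\Gamma)$, ordered by inclusion. In a lattice $L$, write $a\succ b$ if $a>b$ and there is no $x\in L$ with $a>x>b$. The lattice $L$ is lower semimodular if, for all $a,b\in L$, $a\vee b\succ a$ and $a\vee b\succ b$ imply $a\succ a\wedge b$ and $b\succ a\wedge b$; it is modular if, for all $a,b,c\in L$, $a\le c$ implies $a\vee(b\wedge c)=(a\vee b)\wedge c$; it is distributive if $(a\vee b)\wedge c=(a\wedge c)\vee(b\wedge c)$ for all $a,b,c\in L$. **Theorem.** For every directed graph $\Gamma$,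 the following statements are equivalent: (i) the lattice $\mathscr{C}(\mathrm{Inv}(\Gamma))$ is lower semimodular; (ii) the lattice $\mathscr{C}(\mathrm{Inv}(\Gamma))$ is modular; (iii) the lattice $\mathscr{C}(\mathrm{Inv}(\Gamma))$ is distributive. -/

import Mathlib

universe u v

/-- A directed graph with vertex set `V` and edge set `E`: every edge has a source and a range.
Loops and parallel edges are allowed, and `V`, `E` may be empty or infinite. -/
structure DirectedGraph (V : Type u) (E : Type v) where
  s : E → V
  r : E → V

namespace DirectedGraph

/-- The generators of the graph inverse semigroup: the vertices `v`, the edges `e`, and a formal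
symbol `e*` for every edge `e`. -/
inductive Gen (V : Type u) (E : Type v) : Type (max u v)
  | vertex : V → Gen V E
  | edge : E → Gen V E
  | star : E → Gen V E

/-- The free semigroup with zero on the generators: nonempty words, with a zero adjoined. -/
abbrev Word (V : Type u) (E : Type v) : Type (max u v) := WithZero (FreeSemigroup (Gen V E))

/-- A vertex as a one-letter word. -/
def Word.vertex {V : Type u} {E : Type v} (x : V) : Word V E :=
  ((FreeSemigroup.of (Gen.vertex x) : FreeSemigroup (Gen V E)) : Word V E)

/-- An edge as a one-letter word. -/
def Word.edge {V : Type u} {E : Type v} (e : E) : Word V E :=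
  ((FreeSemigroup.of (Gen.edge e) : FreeSemigroup (Gen V E)) : Word V E)

/-- The symbol `e*` as a one-letter word. -/
def Word.star {V : Type u} {E : Type v} (e : E) : Word V E :=
  ((FreeSemigroup.of (Gen.star e) : FreeSemigroup (Gen V E)) : Word V E)

/-- The defining relations of the graph inverse semigroup of `G`. -/
inductive Rel {V : Type u} {E : Type v} (G : DirectedGraph V E) : Word V E → Word V E → Prop
  /-- `x x = x` -/
  | vertex_mul_self (x : V) : Rel G (Word.vertex x * Word.vertex x) (Word.vertex x)
  /-- `x y = 0` for `x ≠ y` -/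
  | vertex_mul_of_ne (x y : V) (h : x ≠ y) : Rel G (Word.vertex x * Word.vertex y) 0
  /-- `s(e) e = e` -/
  | source_mul_edge (e : E) : Rel G (Word.vertex (G.s e) * Word.edge e) (Word.edge e)
  /-- `e r(e) = e` -/
  | edge_mul_range (e : E) : Rel G (Word.edge e * Word.vertex (G.r e)) (Word.edge e)
  /-- `r(e) e* = e*` -/
  | range_mul_star (e : E) : Rel G (Word.vertex (G.r e) * Word.star e) (Word.star e)
  /-- `e* s(e) = e*` -/
  | star_mul_source (e : E) : Rel G (Word.star e * Word.vertex (G.s e)) (Word.star e)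
  /-- `e* e = r(e)` -/
  | star_mul_edge_self (e : E) : Rel G (Word.star e * Word.edge e) (Word.vertex (G.r e))
  /-- `f* e = 0` for `f ≠ e` -/
  | star_mul_edge_of_ne (f e : E) (h : f ≠ e) : Rel G (Word.star f * Word.edge e) 0

/-- The graph inverse semigroup `Inv(G)`: the semigroup with zero presented by the vertices, the
edges and the symbols `e*`, subject to the relations `DirectedGraph.Rel`. -/
def Inv {V : Type u} {E : Type v} (G : DirectedGraph V E) : Type (max u v) :=
  (conGen G.Rel).Quotient

instance {V : Type u} {E : Type v} (G : DirectedGraph V E) : SemigroupWithZero G.Inv where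
  mul := ((conGen G.Rel).hasMul).mul
  mul_assoc := (inferInstance : Semigroup (conGen G.Rel).Quotient).mul_assoc
  zero := ((0 : Word V E) : (conGen G.Rel).Quotient)
  zero_mul a := Con.induction_on (c := conGen G.Rel) a fun x =>
    congrArg (fun w : Word V E => (w : (conGen G.Rel).Quotient)) (zero_mul x)
  mul_zero a := Con.induction_on (c := conGen G.Rel) a fun x =>
    congrArg (fun w : Word V E => (w : (conGen G.Rel).Quotient)) (mul_zero x)

end DirectedGraph

/-! Every element is zero or αβ* for paths α, β with a common end, so a congruence is determined by
the pairs of three kinds that it contains (`con_of_basic_pairs`): (v, 0), (s(e), ee*), and (v, p)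
with p a closed path at v. The obstruction to all three lattice properties is a fork (`Forks`).

Without forks, (a ⊔ b) ⊓ c ≤ (a ⊓ c) ⊔ (b ⊓ c) is checked on each kind of pair. A vertex that is
zero in a ⊔ b is joined, by finitely many relations s(e) ~ ee* from a or b, to a vertex that is zero
in a or in b (`JoinKernel.of_sup`). Two congruences that keep v nonzero and relate it to ee* and ff*
with e ≠ f would make e, f a fork, so c and the join must use the same edge (`inf_edge_idem`). If
the join keeps v nonzero and identifies it with a nonempty closed path, then closed paths at v are
determined by their lengths, the lengths identified with v form subgroups of ℤ, and the claim
reduces to distributivity of the subgroup lattice of ℤ (`inf_closed_path`).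

With a fork e, f at v, let J collapse everything reachable from v. It covers a congruence p with v ~
ee* and r(f) ~ 0, and a congruence q with v ~ ff* and r(e) ~ 0, and p ⊔ q = J. The class of v under
p ⊓ q is a singleton and stays so after adjoining r(f) ~ 0; this gives a congruence strictly between
p ⊓ q and p, against lower semimodularity. The implications from distributive to modular to lower
semimodular are general lattice theory. -/

namespace DirectedGraph

/-! ### Generators and defining relations in the quotient -/

section Generators

variable {V : Type u} {E : Type v} (G : DirectedGraph V E)

/-- The class of a generator in the graph inverse semigroup. -/
def gen (g : Gen V E) : G.Inv :=
  (((FreeSemigroup.of g : FreeSemigroup (Gen V E)) : Word V E) : (conGen G.Rel).Quotient)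

/-- A vertex as an element of the graph inverse semigroup. -/
abbrev vert (x : V) : G.Inv := G.gen (Gen.vertex x)

/-- An edge as an element of the graph inverse semigroup. -/
abbrev edge (e : E) : G.Inv := G.gen (Gen.edge e)

/-- The inverse of an edge in the graph inverse semigroup. -/
abbrev star (e : E) : G.Inv := G.gen (Gen.star e)

variable {G}

theorem coe_eq_of_rel {x y : Word V E} (h : G.Rel x y) :
    (x : (conGen G.Rel).Quotient) = (y : (conGen G.Rel).Quotient) :=
  (Con.eq _).2 (ConGen.Rel.of _ _ h)

theorem vert_mul_self (x : V) : G.vert x * G.vert x = G.vert x :=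
  coe_eq_of_rel (Rel.vertex_mul_self x)

theorem vert_mul_of_ne {x y : V} (h : x ≠ y) : G.vert x * G.vert y = 0 :=
  coe_eq_of_rel (Rel.vertex_mul_of_ne x y h)

theorem source_mul_edge (e : E) : G.vert (G.s e) * G.edge e = G.edge e :=
  coe_eq_of_rel (Rel.source_mul_edge e)

theorem edge_mul_range (e : E) : G.edge e * G.vert (G.r e) = G.edge e :=
  coe_eq_of_rel (Rel.edge_mul_range e)

theorem range_mul_star (e : E) : G.vert (G.r e) * G.star e = G.star e :=
  coe_eq_of_rel (Rel.range_mul_star e)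

theorem star_mul_source (e : E) : G.star e * G.vert (G.s e) = G.star e :=
  coe_eq_of_rel (Rel.star_mul_source e)

theorem star_mul_edge_self (e : E) : G.star e * G.edge e = G.vert (G.r e) :=
  coe_eq_of_rel (Rel.star_mul_edge_self e)

theorem star_mul_edge_of_ne {f e : E} (h : f ≠ e) : G.star f * G.edge e = 0 :=
  coe_eq_of_rel (Rel.star_mul_edge_of_ne f e h)

theorem Inv.induction {P : G.Inv → Prop} (zero : P 0) (of : ∀ g, P (G.gen g))
    (gen_mul : ∀ g x, P x → P (G.gen g * x)) (x : G.Inv) : P x := by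
  refine Con.induction_on (c := conGen G.Rel) x fun w => ?_
  induction w using WithZero.recZeroCoe with
  | zero => exact zero
  | coe w =>
    induction w using FreeSemigroup.recOnMul with
    | ih1 g => exact of g
    | ih2 g w _ hw => exact gen_mul g _ hw

theorem edge_mul_vert_of_ne {e : E} {x : V} (h : G.r e ≠ x) : G.edge e * G.vert x = 0 := by
  rw [← edge_mul_range, mul_assoc, vert_mul_of_ne h, mul_zero]

theorem star_mul_vert_of_ne {e : E} {x : V} (h : G.s e ≠ x) : G.star e * G.vert x = 0 := by
  rw [← star_mul_source, mul_assoc, vert_mul_of_ne h, mul_zero]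

end Generators

/-! ### Paths, their inverses and normal forms -/

section Paths

variable {V : Type u} {E : Type v} (G : DirectedGraph V E)

/-- `G.IsPath x l y`: the list of edges `l` is a path from `x` to `y`. -/
def IsPath : V → List E → V → Prop
  | x, [], y => x = y
  | x, e :: l, y => G.s e = x ∧ IsPath (G.r e) l y

/-- The element of the graph inverse semigroup given by a path starting at a given vertex. -/
def path : V → List E → G.Inv
  | x, [] => G.vert x
  | _, e :: l => G.edge e * path (G.r e) l

/-- The inverse of `G.path x l`. -/
def copath : V → List E → G.Inv
  | x, [] => G.vert x
  | _, e :: l => copath (G.r e) l * G.star e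

/-- `G.Reach x y`: there is a path from `x` to `y`. -/
def Reach (x y : V) : Prop := ∃ l, G.IsPath x l y

variable {G}

theorem IsPath.append {x y z : V} {l m : List E} (hl : G.IsPath x l y) (hm : G.IsPath y m z) :
    G.IsPath x (l ++ m) z := by
  induction l generalizing x with
  | nil => cases hl; exact hm
  | cons e l ih => exact ⟨hl.1, ih hl.2⟩

theorem Reach.refl (x : V) : G.Reach x x := ⟨[], rfl⟩

theorem Reach.trans {x y z : V} (h : G.Reach x y) (h' : G.Reach y z) : G.Reach x z :=
  ⟨_, h.choose_spec.append h'.choose_spec⟩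

theorem Reach.edge (e : E) : G.Reach (G.s e) (G.r e) := ⟨[e], rfl, rfl⟩

theorem IsPath.singleton (e : E) : G.IsPath (G.s e) [e] (G.r e) := ⟨rfl, rfl⟩

@[simp] theorem path_nil (x : V) : G.path x [] = G.vert x := rfl

@[simp] theorem path_cons (x : V) (e : E) (l : List E) :
    G.path x (e :: l) = G.edge e * G.path (G.r e) l := rfl

@[simp] theorem copath_nil (x : V) : G.copath x [] = G.vert x := rfl

@[simp] theorem copath_cons (x : V) (e : E) (l : List E) :
    G.copath x (e :: l) = G.copath (G.r e) l * G.star e := rfl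

theorem IsPath.vert_mul_path {x y : V} {l : List E} (h : G.IsPath x l y) :
    G.vert x * G.path x l = G.path x l := by
  cases l with
  | nil => exact vert_mul_self x
  | cons e l => rw [path_cons, ← mul_assoc, ← h.1, source_mul_edge]

theorem IsPath.copath_mul_vert {x y : V} {l : List E} (h : G.IsPath x l y) :
    G.copath x l * G.vert x = G.copath x l := by
  cases l with
  | nil => exact vert_mul_self x
  | cons e l => rw [copath_cons, mul_assoc, ← h.1, star_mul_source]

theorem IsPath.path_mul_vert {x y : V} {l : List E} (h : G.IsPath x l y) :
    G.path x l * G.vert y = G.path x l := by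
  induction l generalizing x with
  | nil => cases h; exact vert_mul_self _
  | cons e l ih => rw [path_cons, mul_assoc, ih h.2]

theorem IsPath.vert_mul_copath {x y : V} {l : List E} (h : G.IsPath x l y) :
    G.vert y * G.copath x l = G.copath x l := by
  induction l generalizing x with
  | nil => cases h; exact vert_mul_self _
  | cons e l ih => rw [copath_cons, ← mul_assoc, ih h.2]

theorem IsPath.path_append {x y : V} {l : List E} (h : G.IsPath x l y) {z : V} {m : List E}
    (hm : G.IsPath y m z) : G.path x (l ++ m) = G.path x l * G.path y m := by
  induction l generalizing x with
  | nil => cases h; exact hm.vert_mul_path.symm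
  | cons e l ih => rw [List.cons_append, path_cons, ih h.2, path_cons, mul_assoc]

theorem IsPath.copath_append {x y : V} {l : List E} (h : G.IsPath x l y) {z : V} {m : List E}
    (hm : G.IsPath y m z) : G.copath x (l ++ m) = G.copath y m * G.copath x l := by
  induction l generalizing x with
  | nil => cases h; exact hm.copath_mul_vert.symm
  | cons e l ih => rw [List.cons_append, copath_cons, ih h.2, copath_cons, mul_assoc]

theorem IsPath.copath_mul_path {x y : V} {l : List E} (h : G.IsPath x l y) :
    G.copath x l * G.path x l = G.vert y := by
  induction l generalizing x with
  | nil => cases h; exact vert_mul_self _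
  | cons e l ih =>
    rw [copath_cons, path_cons, mul_assoc, ← mul_assoc (G.star e), star_mul_edge_self]
    rw [h.2.vert_mul_path, ih h.2]

/-- Of two paths whose product `α* γ` is non-zero, one extends the other. -/
theorem copath_mul_path_eq_zero_or {x x' y y' : V} {l m : List E} (hl : G.IsPath x l y)
    (hm : G.IsPath x' m y') : G.copath x l * G.path x' m = 0 ∨
      (x = x' ∧ ((∃ k, m = l ++ k ∧ G.IsPath y k y') ∨ ∃ k, l = m ++ k ∧ G.IsPath y' k y)) := by
  by_cases hx : x = x'
  swap
  · left
    rw [← hl.copath_mul_vert, ← hm.vert_mul_path, mul_assoc, ← mul_assoc (G.vert x),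
      vert_mul_of_ne hx, zero_mul, mul_zero]
  subst hx
  induction l generalizing x m with
  | nil => cases hl; exact Or.inr ⟨rfl, Or.inl ⟨m, rfl, hm⟩⟩
  | cons e l ih =>
    cases m with
    | nil => cases hm; exact Or.inr ⟨rfl, Or.inr ⟨e :: l, rfl, hl⟩⟩
    | cons f m =>
      rw [copath_cons, path_cons, mul_assoc, ← mul_assoc (G.star e)]
      by_cases hef : e = f
      · subst hef
        rw [star_mul_edge_self, hm.2.vert_mul_path]
        rcases ih hl.2 hm.2 with h | ⟨-, ⟨k, rfl, hk⟩ | ⟨k, rfl, hk⟩⟩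
        · exact Or.inl h
        · exact Or.inr ⟨rfl, Or.inl ⟨k, rfl, hk⟩⟩
        · exact Or.inr ⟨rfl, Or.inr ⟨k, rfl, hk⟩⟩
      · left
        rw [star_mul_edge_of_ne hef, zero_mul, mul_zero]

/-- The elements of this shape are closed under left multiplication by generators. Only existence is
needed; uniqueness of the normal form is never used. -/
theorem exists_normal_form (x : G.Inv) :
    x = 0 ∨ ∃ a l b m c, G.IsPath a l c ∧ G.IsPath b m c ∧ x = G.path a l * G.copath b m := by
  induction x using Inv.induction with
  | zero => exact Or.inl rfl
  | of g =>
    cases g with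
    | vertex x => exact Or.inr ⟨x, [], x, [], x, rfl, rfl, (vert_mul_self x).symm⟩
    | edge e =>
      refine Or.inr ⟨_, [e], _, [], _, IsPath.singleton e, rfl, ?_⟩
      simp only [path_cons, path_nil, copath_nil, mul_assoc, vert_mul_self]
      exact (edge_mul_range e).symm
    | star e =>
      refine Or.inr ⟨_, [], _, [e], _, rfl, IsPath.singleton e, ?_⟩
      simp only [path_nil, copath_cons, copath_nil, ← mul_assoc, vert_mul_self]
      exact (range_mul_star e).symm
  | gen_mul g x hx =>
    rcases hx with rfl | ⟨a, l, b, m, c, hl, hm, rfl⟩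
    · exact Or.inl (mul_zero _)
    cases g with
    | vertex y =>
      by_cases h : y = a
      · subst h
        exact Or.inr ⟨_, l, b, m, c, hl, hm, by rw [← mul_assoc, hl.vert_mul_path]⟩
      · left
        rw [← hl.vert_mul_path, ← mul_assoc, ← mul_assoc, vert_mul_of_ne h, zero_mul, zero_mul]
    | edge e =>
      by_cases h : G.r e = a
      · subst h
        exact Or.inr ⟨G.s e, e :: l, b, m, c, ⟨rfl, hl⟩, hm, by rw [path_cons, mul_assoc]⟩
      · left
        rw [← hl.vert_mul_path, ← mul_assoc, ← mul_assoc, edge_mul_vert_of_ne h, zero_mul,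
          zero_mul]
    | star e =>
      by_cases h : G.s e = a
      swap
      · left
        rw [← hl.vert_mul_path, ← mul_assoc, ← mul_assoc, star_mul_vert_of_ne h, zero_mul,
          zero_mul]
      subst h
      cases l with
      | nil =>
        cases hl
        refine Or.inr ⟨_, [], _, m ++ [e], _, rfl, hm.append (IsPath.singleton e), ?_⟩
        rw [hm.copath_append (IsPath.singleton e)]
        simp only [path_nil, copath_cons, copath_nil]
        rw [range_mul_star, ← mul_assoc, star_mul_source, ← mul_assoc, range_mul_star]
      | cons f l =>
        rw [path_cons, ← mul_assoc, ← mul_assoc]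
        by_cases hef : e = f
        · subst hef
          rw [star_mul_edge_self, hl.2.vert_mul_path]
          exact Or.inr ⟨_, l, _, m, c, hl.2, hm, rfl⟩
        · left
          rw [star_mul_edge_of_ne hef, zero_mul, zero_mul]

end Paths

/-! ### Congruences and the basic pairs that determine them -/

section Congruences

variable {V : Type u} {E : Type v} {G : DirectedGraph V E}

theorem con_mul_left {ρ : Con G.Inv} (z : G.Inv) {x y : G.Inv} (h : ρ x y) : ρ (z * x) (z * y) :=
  ρ.mul (ρ.refl z) h

theorem con_mul_right {ρ : Con G.Inv} (z : G.Inv) {x y : G.Inv} (h : ρ x y) : ρ (x * z) (y * z) :=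
  ρ.mul h (ρ.refl z)

theorem con_zero_of_isPath {ρ : Con G.Inv} {x y : V} {l : List E} (hl : G.IsPath x l y)
    (h : ρ (G.vert x) 0) : ρ (G.vert y) 0 := by
  have := con_mul_right (G.path x l) (con_mul_left (G.copath x l) h)
  rwa [mul_zero, zero_mul, hl.copath_mul_vert, hl.copath_mul_path] at this

theorem con_zero_of_path_mul_copath {ρ : Con G.Inv} {a b c : V} {l m : List E}
    (hl : G.IsPath a l c) (hm : G.IsPath b m c)
    (h : ρ (G.path a l * G.copath b m) 0) : ρ (G.vert c) 0 := by
  have := con_mul_right (G.path b m) (con_mul_left (G.copath a l) h)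
  rwa [mul_zero, zero_mul, ← mul_assoc, hl.copath_mul_path, mul_assoc, hm.copath_mul_path,
    vert_mul_self] at this

theorem con_path_mul_copath_zero {ρ : Con G.Inv} {a b c : V} {l m : List E}
    (hl : G.IsPath a l c) (h : ρ (G.vert c) 0) : ρ (G.path a l * G.copath b m) 0 := by
  have := con_mul_right (G.copath b m) (con_mul_left (G.path a l) h)
  rwa [mul_zero, zero_mul, hl.path_mul_vert] at this

theorem con_edge_mul_star_zero {ρ : Con G.Inv} {e : E} (h : ρ (G.vert (G.r e)) 0) :
    ρ (G.edge e * G.star e) 0 := by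
  have := con_mul_right (G.star e) (con_mul_left (G.edge e) h)
  rwa [mul_zero, zero_mul, edge_mul_range] at this

theorem con_edge_mul_star_of_zero {ρ : Con G.Inv} {e : E} (h : ρ (G.vert (G.s e)) 0) :
    ρ (G.vert (G.s e)) (G.edge e * G.star e) :=
  ρ.trans h (ρ.symm (con_edge_mul_star_zero (con_zero_of_isPath (IsPath.singleton e) h)))

theorem con_path_of_zero {ρ : Con G.Inv} {x y : V} {l : List E} (hl : G.IsPath x l y)
    (h : ρ (G.vert x) 0) : ρ (G.vert x) (G.path x l) := by
  have := con_mul_right (G.path x l) h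
  rw [zero_mul, hl.vert_mul_path] at this
  exact ρ.trans h (ρ.symm this)

theorem con_idem_of_mul_eq {ρ : Con G.Inv} {x y : V} {l : List E} (hl : G.IsPath x l y)
    {z : G.Inv} (h : ρ (G.vert x) z) (hz : G.path x l * G.copath x l * z = z) :
    ρ (G.vert x) (G.path x l * G.copath x l) := by
  have := con_mul_left (G.path x l * G.copath x l) h
  rw [hz, mul_assoc, hl.copath_mul_vert] at this
  exact ρ.trans h (ρ.symm this)

theorem con_edge_idem_of_mul_eq {ρ : Con G.Inv} {e : E}
    {z : G.Inv} (h : ρ (G.vert (G.s e)) z) (hz : G.edge e * G.star e * z = z) :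
    ρ (G.vert (G.s e)) (G.edge e * G.star e) := by
  have := con_mul_left (G.edge e * G.star e) h
  rw [hz, mul_assoc, star_mul_source] at this
  exact ρ.trans h (ρ.symm this)

/-- Left multiplication by ee* fixes the right-hand side, which gives the first relation;
conjugation by e strips the first edge and gives the second. Hence relations v ~ ll* reduce to
single edges. -/
theorem con_idem_cons {ρ : Con G.Inv} {e : E} {y : V} {l : List E}
    (hl : G.IsPath (G.r e) l y)
    (h : ρ (G.vert (G.s e)) (G.path (G.s e) (e :: l) * G.copath (G.s e) (e :: l))) :
    ρ (G.vert (G.s e)) (G.edge e * G.star e) ∧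
      ρ (G.vert (G.r e)) (G.path (G.r e) l * G.copath (G.r e) l) := by
  constructor
  · refine con_edge_idem_of_mul_eq h ?_
    simp only [path_cons, ← mul_assoc]
    rw [mul_assoc (G.edge e), star_mul_edge_self, edge_mul_range]
  · have := con_mul_right (G.edge e) (con_mul_left (G.star e) h)
    rw [star_mul_source, star_mul_edge_self] at this
    simp only [path_cons, copath_cons, mul_assoc] at this
    rw [star_mul_edge_self, ← mul_assoc (G.star e), star_mul_edge_self, ← mul_assoc,
      hl.vert_mul_path, hl.copath_mul_vert] at this
    exact this

/-- Elements congruent to a vertex outside the zero class. -/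
theorem con_vert_cases {ρ : Con G.Inv} {v : V} {x : G.Inv} (h : ρ (G.vert v) x) :
    ρ (G.vert v) 0 ∨ ∃ l m c, G.IsPath v l c ∧ G.IsPath v m c ∧
      x = G.path v l * G.copath v m := by
  rcases exists_normal_form x with rfl | ⟨a, l, b, m, c, hl, hm, rfl⟩
  · exact Or.inl h
  by_cases ha : v = a
  swap
  · left
    have := con_mul_left (G.vert v) h
    rwa [vert_mul_self, ← hl.vert_mul_path, ← mul_assoc, ← mul_assoc, vert_mul_of_ne ha, zero_mul,
      zero_mul] at this
  by_cases hb : b = v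
  swap
  · left
    have := con_mul_right (G.vert v) h
    rwa [vert_mul_self, ← hm.copath_mul_vert, mul_assoc, mul_assoc, vert_mul_of_ne hb, mul_zero,
      mul_zero] at this
  subst ha hb
  exact Or.inr ⟨l, m, c, hl, hm, rfl⟩

theorem con_vert_eq_or_edge {ρ : Con G.Inv} {v : V} {x : G.Inv} (h : ρ (G.vert v) x) :
    ρ (G.vert v) 0 ∨ x = G.vert v ∨
      ∃ e, G.s e = v ∧ ρ (G.vert v) (G.edge e * G.star e) := by
  rcases con_vert_cases h with h0 | ⟨l, m, c, hl, hm, rfl⟩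
  · exact Or.inl h0
  right
  cases l with
  | cons e l =>
    obtain ⟨rfl, hl⟩ := hl
    refine Or.inr ⟨e, rfl, con_edge_idem_of_mul_eq h ?_⟩
    simp only [path_cons, ← mul_assoc]
    rw [mul_assoc (G.edge e), star_mul_edge_self, edge_mul_range]
  | nil =>
    cases hl
    cases m with
    | nil => exact Or.inl (vert_mul_self _)
    | cons e m =>
      obtain ⟨rfl, hm⟩ := hm
      refine Or.inr ⟨e, rfl, ?_⟩
      have := con_mul_right (G.edge e * G.star e) h
      rw [← mul_assoc, source_mul_edge, copath_cons, mul_assoc, mul_assoc, ← mul_assoc (G.star e),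
        star_mul_edge_self, range_mul_star] at this
      exact ρ.trans h (ρ.symm this)

/-- If `ρ` identifies `s(e)` with `e e*`, the other edges leaving `s(e)` end in the zero class. -/
theorem con_range_zero {ρ : Con G.Inv} {e g : E}
    (h : ρ (G.vert (G.s e)) (G.edge e * G.star e)) (hs : G.s g = G.s e) (hne : g ≠ e) :
    ρ (G.vert (G.r g)) 0 := by
  have := con_mul_right (G.edge g) (con_mul_left (G.star g) h)
  rwa [← hs, star_mul_source, star_mul_edge_self, ← mul_assoc, star_mul_edge_of_ne hne, zero_mul,
    zero_mul] at this

theorem con_idem_transfer {ρ σ : Con G.Inv}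
    (h1 : ∀ e, ρ (G.vert (G.s e)) (G.edge e * G.star e) →
      σ (G.vert (G.s e)) (G.edge e * G.star e))
    {x y : V} {l : List E} (hl : G.IsPath x l y)
    (h : ρ (G.vert x) (G.path x l * G.copath x l)) :
    σ (G.vert x) (G.path x l * G.copath x l) := by
  induction l generalizing x with
  | nil =>
    cases hl
    simpa [vert_mul_self] using σ.refl _
  | cons e l ih =>
    obtain ⟨rfl, hl⟩ := hl
    obtain ⟨h2, h3⟩ := con_idem_cons hl h
    have := con_mul_right (G.star e) (con_mul_left (G.edge e) (ih hl h3))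
    rw [edge_mul_range] at this
    refine σ.trans (h1 e h2) ?_
    simpa only [path_cons, copath_cons, mul_assoc] using this

/-- Congruences on a graph inverse semigroup are determined by the pairs `(v, 0)`, `(s(e), e e*)`
and `(v, p)` with `p` a closed path at `v` that they contain. -/
theorem con_of_basic_pairs {ρ σ : Con G.Inv}
    (h0 : ∀ v, ρ (G.vert v) 0 → σ (G.vert v) 0)
    (h1 : ∀ e, ρ (G.vert (G.s e)) (G.edge e * G.star e) →
      σ (G.vert (G.s e)) (G.edge e * G.star e))
    (h2 : ∀ v l, G.IsPath v l v → ρ (G.vert v) (G.path v l) → σ (G.vert v) (G.path v l)) :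
    ρ ≤ σ := by
  have hzero : ∀ x, ρ x 0 → σ x 0 := by
    intro x hx
    rcases exists_normal_form x with rfl | ⟨a, l, b, m, c, hl, hm, rfl⟩
    · exact σ.refl _
    · exact con_path_mul_copath_zero hl (h0 _ (con_zero_of_path_mul_copath hl hm hx))
  -- Related nonzero normal forms have comparable left paths, so up to symmetry the second extends
  -- the first by k. Conjugating by the outer paths of either side gives c ~ k(n*m) and k*(m*n) ~
  -- c', and the remaining cases compare m with n.
  have key : ∀ {a l b m c k b' n c'}, G.IsPath a l c → G.IsPath b m c → G.IsPath b' n c' →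
      G.IsPath c k c' → ¬ ρ (G.vert c) 0 → ¬ ρ (G.vert c') 0 →
      ρ (G.path a l * G.copath b m) (G.path a (l ++ k) * G.copath b' n) →
      σ (G.path a l * G.copath b m) (G.path a (l ++ k) * G.copath b' n) := by
    intro a l b m c k b' n c' hl hm hn hk hc hc' h
    have hu := con_mul_right (G.path b m) (con_mul_left (G.copath a l) h)
    have hw := con_mul_right (G.path b' n) (con_mul_left (G.copath a (l ++ k)) h)
    rw [hl.path_append hk] at h hu hw ⊢
    rw [hl.copath_append hk] at hw
    simp only [← mul_assoc] at hu hw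
    rw [hl.copath_mul_path, hm.vert_mul_copath, hm.copath_mul_path,
      hk.vert_mul_path, mul_assoc] at hu
    rw [mul_assoc (G.copath c k) (G.copath a l), hl.copath_mul_path, hk.copath_mul_vert,
      hk.copath_mul_path, hn.vert_mul_copath, hn.copath_mul_path, mul_assoc] at hw
    rcases copath_mul_path_eq_zero_or hn hm with h' | ⟨rfl, ⟨j, rfl, hj⟩ | ⟨j, rfl, hj⟩⟩
    · rw [h', mul_zero] at hu
      exact absurd hu hc
    -- Here c ~ kj is a closed-path pair and c' ~ jj*; both transfer to σ, where then j* ~ kjj* ~ k.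
    · rw [hn.copath_append hj] at hw ⊢
      rw [hn.path_append hj] at hu
      rw [← mul_assoc (G.copath _ n), hn.copath_mul_path, hj.vert_mul_path] at hu
      rw [mul_assoc (G.copath c' j), hn.copath_mul_path, hj.copath_mul_vert] at hw
      have hidem : ρ (G.vert c') (G.path c' j * G.copath c' j) := by
        have := con_mul_right (G.path c' j * G.copath c' j) hw
        rw [mul_assoc, ← mul_assoc (G.copath c' j), hj.copath_mul_path, hj.vert_mul_copath,
          ← mul_assoc, hj.vert_mul_path] at this
        exact (ρ.trans (ρ.symm hw) this)
      have hσ := con_idem_transfer h1 hj hidem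
      have hcl : σ (G.vert c) (G.path c k * G.path c' j) := by
        have := h2 c (k ++ j) (hk.append hj)
        rw [hk.path_append hj] at this
        exact this hu
      have e1 := con_mul_right (G.copath c' j) hcl
      have e2 := con_mul_left (G.path c k) hσ
      rw [hj.vert_mul_copath] at e1
      rw [hk.path_mul_vert] at e2
      rw [mul_assoc] at e1
      have e3 := con_mul_right (G.copath b' n) (con_mul_left (G.path a l) (σ.trans e1 (σ.symm e2)))
      simpa only [mul_assoc] using e3
    · rw [hm.copath_append hj] at hu ⊢
      rw [hm.path_append hj] at hw
      rw [mul_assoc (G.copath c j), hm.copath_mul_path, hj.copath_mul_vert] at hu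
      rw [← mul_assoc (G.copath _ m), hm.copath_mul_path, hj.vert_mul_path] at hw
      suffices hs : σ (G.vert c) (G.path c k * G.copath c j) by
        have e3 := con_mul_right (G.copath b' m) (con_mul_left (G.path a l) hs)
        rw [hl.path_mul_vert] at e3
        simpa only [mul_assoc] using e3
      -- Now c ~ kj*. The paths k and j differ by a closed path i at the end of the shorter one, and
      -- that end is related to i. So the pair follows from c ~ tt*, with t the shorter path, and a
      -- closed-path pair.
      rcases copath_mul_path_eq_zero_or hk hj with h' | ⟨-, ⟨i, rfl, hi⟩ | ⟨i, rfl, hi⟩⟩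
      · rw [h'] at hw
        exact absurd (ρ.symm hw) hc'
      · rw [hk.path_append hi, ← mul_assoc, hk.copath_mul_path, hi.vert_mul_path] at hw
        rw [hk.copath_append hi] at hu ⊢
        have hσ := h2 _ _ hi (ρ.symm hw)
        have hidem := con_idem_of_mul_eq hk hu (by
          simp only [← mul_assoc]
          rw [mul_assoc (G.path c k), hk.copath_mul_path, hk.path_mul_vert])
        have hσ' := con_idem_transfer h1 hk hidem
        have e1 := con_mul_left (G.copath c' i) hσ
        rw [hi.copath_mul_path, hi.copath_mul_vert] at e1
        have e2 := con_mul_right (G.copath c k) (con_mul_left (G.path c k) (σ.symm e1))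
        rw [hk.path_mul_vert, mul_assoc] at e2
        exact σ.trans hσ' e2
      · rw [hj.copath_append hi, mul_assoc, hj.copath_mul_path, hi.copath_mul_vert] at hw
        rw [hj.path_append hi] at hu ⊢
        have hcl : ρ (G.vert c') (G.path c' i) := by
          have := con_mul_right (G.path c' i) hw
          rw [hi.copath_mul_path, hi.vert_mul_path] at this
          exact this
        have hσ := h2 _ _ hi hcl
        have hidem := con_idem_of_mul_eq hj hu (by
          simp only [← mul_assoc]
          rw [mul_assoc (G.path c j), hj.copath_mul_path, hj.path_mul_vert])
        have hσ' := con_idem_transfer h1 hj hidem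
        have e2 := con_mul_right (G.copath c j) (con_mul_left (G.path c j) hσ)
        rw [hj.path_mul_vert] at e2
        exact σ.trans hσ' e2
  intro x y hxy
  by_cases hx : ρ x 0
  · exact σ.trans (hzero x hx) (σ.symm (hzero y (ρ.trans (ρ.symm hxy) hx)))
  have hy : ¬ ρ y 0 := fun h => hx (ρ.trans hxy h)
  rcases exists_normal_form x with rfl | ⟨a, l, b, m, c, hl, hm, rfl⟩
  · exact absurd (ρ.refl _) hx
  rcases exists_normal_form y with rfl | ⟨a', l', b', m', c', hl', hm', rfl⟩
  · exact absurd (ρ.refl _) hy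
  have hc : ¬ ρ (G.vert c) 0 := fun h => hx (con_path_mul_copath_zero hl h)
  have hc' : ¬ ρ (G.vert c') 0 := fun h => hy (con_path_mul_copath_zero hl' h)
  rcases copath_mul_path_eq_zero_or hl hl' with h | ⟨rfl, ⟨k, rfl, hk⟩ | ⟨k, rfl, hk⟩⟩
  · have := con_mul_left (G.copath a l) hxy
    rw [← mul_assoc, ← mul_assoc, h, zero_mul, hl.copath_mul_path] at this
    have h3 := con_mul_right (G.path b m) this
    rw [mul_assoc, hm.copath_mul_path, vert_mul_self, zero_mul] at h3
    exact absurd h3 hc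
  · exact key hl hm hm' hk hc hc' hxy
  · exact σ.symm (key hl' hm' hm hk hc' hc (ρ.symm hxy))

end Congruences

/-! ### Joins of congruences and their zero classes -/

section Joins

/-- The join of two congruences consists of the pairs joined by a chain of pairs from either. -/
theorem con_sup_chain {M : Type*} [Mul M] {a b : Con M} {x y : M} (h : (a ⊔ b) x y) :
    Relation.ReflTransGen (fun x y => ∃ c, (c = a ∨ c = b) ∧ c x y) x y := by
  have hsymm : ∀ {x y : M}, Relation.ReflTransGen (fun x y => ∃ c, (c = a ∨ c = b) ∧ c x y) x y →
      Relation.ReflTransGen (fun x y => ∃ c, (c = a ∨ c = b) ∧ c x y) y x := by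
    intro x y h
    induction h with
    | refl => exact .refl
    | tail _ h ih => exact ih.head (h.imp fun c hc => ⟨hc.1, c.symm hc.2⟩)
  let j : Con M :=
    { r := Relation.ReflTransGen (fun x y => ∃ c, (c = a ∨ c = b) ∧ c x y)
      iseqv := ⟨fun _ => .refl, hsymm, fun h h' => h.trans h'⟩
      mul' := by
        intro w x y z h h'
        refine Relation.ReflTransGen.trans (b := x * y)
          (Relation.ReflTransGen.lift (· * y) ?_ _ _ h) (Relation.ReflTransGen.lift (x * ·) ?_ _ _ h')
        · exact fun p q hpq => hpq.imp fun c hc => ⟨hc.1, c.mul hc.2 (c.refl y)⟩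
        · exact fun p q hpq => hpq.imp fun c hc => ⟨hc.1, c.mul (c.refl x) hc.2⟩ }
  have hj : a ⊔ b ≤ j := sup_le
    (fun {x y} h => Relation.ReflTransGen.single ⟨a, Or.inl rfl, h⟩)
    (fun {x y} h => Relation.ReflTransGen.single ⟨b, Or.inr rfl, h⟩)
  exact hj h

theorem le_sup_of_eq_or {M : Type*} [Mul M] {a b c : Con M} (h : c = a ∨ c = b) : c ≤ a ⊔ b := by
  rcases h with rfl | rfl
  · exact le_sup_left
  · exact le_sup_right

variable {V : Type u} {E : Type v} {G : DirectedGraph V E}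

/-- The vertices that `a ⊔ b` identifies with zero. -/
inductive JoinKernel (a b : Con G.Inv) : V → Prop
  | zero {v : V} (c : Con G.Inv) (hc : c = a ∨ c = b) (h : c (G.vert v) 0) : JoinKernel a b v
  | step (e : E) (c : Con G.Inv) (hc : c = a ∨ c = b)
      (h : c (G.vert (G.s e)) (G.edge e * G.star e)) (hr : JoinKernel a b (G.r e)) :
      JoinKernel a b (G.s e)

namespace JoinKernel

variable {a b : Con G.Inv}

theorem of_edge {v : V} (h : JoinKernel a b v) {g : E} (hg : G.s g = v) :
    JoinKernel a b (G.r g) := by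
  cases h with
  | zero c hc h => subst hg; exact zero c hc (con_zero_of_isPath (IsPath.singleton g) h)
  | step e c hc h hr =>
    by_cases hge : g = e
    · subst hge; exact hr
    · exact zero c hc (con_range_zero h hg hge)

theorem of_isPath {x y : V} {l : List E} (hl : G.IsPath x l y) (h : JoinKernel a b x) :
    JoinKernel a b y := by
  induction l generalizing x with
  | nil => cases hl; exact h
  | cons e l ih => exact ih hl.2 (h.of_edge hl.1)

theorem of_con_idem {c : Con G.Inv} (hc : c = a ∨ c = b) {x y : V} {l : List E}
    (hl : G.IsPath x l y) (h : c (G.vert x) (G.path x l * G.copath x l))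
    (hy : JoinKernel a b y) : JoinKernel a b x := by
  induction l generalizing x with
  | nil => cases hl; exact hy
  | cons e l ih =>
    obtain ⟨rfl, hl⟩ := hl
    obtain ⟨h1, h2⟩ := con_idem_cons hl h
    exact step e c hc h1 (ih hl h2)

/-- Conjugation by l' and m' relates z' to (l'*l)(m*m'). Either this is 0, or l = l'k and z' ~ kk*
with k ending in z, or z' is reachable from z. -/
theorem of_con {c : Con G.Inv} (hc : c = a ∨ c = b) {x y z x' y' z' : V} {l m l' m' : List E}
    (hl : G.IsPath x l z) (hl' : G.IsPath x' l' z') (hm' : G.IsPath y' m' z')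
    (h : c (G.path x l * G.copath y m) (G.path x' l' * G.copath y' m'))
    (hz : JoinKernel a b z) : JoinKernel a b z' := by
  have hw := con_mul_right (G.path y' m') (con_mul_left (G.copath x' l') h)
  rw [← mul_assoc, ← mul_assoc, hl'.copath_mul_path, hm'.vert_mul_copath,
    hm'.copath_mul_path] at hw
  rcases copath_mul_path_eq_zero_or hl' hl with h0 | ⟨rfl, ⟨k, rfl, hk⟩ | ⟨k, rfl, hk⟩⟩
  · rw [h0, zero_mul, zero_mul] at hw
    exact zero c hc (c.symm hw)
  · rw [hl'.path_append hk, ← mul_assoc, hl'.copath_mul_path, hk.vert_mul_path, mul_assoc] at hw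
    refine of_con_idem hc hk (con_idem_of_mul_eq hk (c.symm hw) ?_) hz
    rw [← mul_assoc, mul_assoc (G.path z' k), hk.copath_mul_path, hk.path_mul_vert]
  · exact of_isPath hk hz

/-- The chain is followed from 0 to v: for every nonzero normal form on it, the common end of the
two paths lies in the kernel. -/
theorem of_sup {v : V} (h : (a ⊔ b) (G.vert v) 0) : JoinKernel a b v := by
  have key : ∀ x, Relation.ReflTransGen (fun x y => ∃ c, (c = a ∨ c = b) ∧ c x y) 0 x →
      ∀ p l q m z, G.IsPath p l z → G.IsPath q m z → x = G.path p l * G.copath q m →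
        JoinKernel a b z := by
    intro x hx
    induction hx with
    | refl =>
      intro p l q m z hl hm h0
      refine zero a (Or.inl rfl) (con_zero_of_path_mul_copath hl hm ?_)
      rw [← h0]
      exact a.refl _
    | @tail y y' _ hyy' ih =>
      rintro p' l' q' m' z' hl' hm' rfl
      obtain ⟨c, hc, hyy'⟩ := hyy'
      rcases exists_normal_form y with rfl | ⟨p, l, q, m, z, hl, hm, rfl⟩
      · exact zero c hc (con_zero_of_path_mul_copath hl' hm' (c.symm hyy'))
      · exact of_con hc hl hl' hm' hyy' (ih _ _ _ _ _ hl hm rfl)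
  exact key _ (con_sup_chain ((a ⊔ b).symm h)) v [] v [] v rfl rfl (vert_mul_self v).symm

end JoinKernel

/-- Only the first link that leaves v matters: it starts at v itself, so `con_vert_eq_or_edge`
applies to it. -/
theorem exists_edge_idem_of_chain {a b : Con G.Inv} {v : V} (hv : ¬ JoinKernel a b v) {x : G.Inv}
    (h : Relation.ReflTransGen (fun x y => ∃ c, (c = a ∨ c = b) ∧ c x y) (G.vert v) x) :
    x = G.vert v ∨ ∃ c, (c = a ∨ c = b) ∧ ∃ e, G.s e = v ∧
      c (G.vert v) (G.edge e * G.star e) := by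
  induction h with
  | refl => exact Or.inl rfl
  | tail _ hxy ih =>
    rcases ih with rfl | ih
    · obtain ⟨c, hc, h⟩ := hxy
      rcases con_vert_eq_or_edge h with h | h | h
      · exact absurd (JoinKernel.zero c hc h) hv
      · exact Or.inl h
      · exact Or.inr ⟨c, hc, h⟩
    · exact Or.inr ih

variable (G) in
/-- `G.Forks e f`: the edges `e ≠ f` leave the same vertex, no other edge at that vertex leads
towards `r(e)` than `e`, and none leads towards `r(f)` than `f`. -/
def Forks (e f : E) : Prop :=
  e ≠ f ∧ G.s e = G.s f ∧ (∀ g, G.s g = G.s e → g ≠ e → ¬ G.Reach (G.r g) (G.r e)) ∧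
    ∀ g, G.s g = G.s e → g ≠ f → ¬ G.Reach (G.r g) (G.r f)

theorem not_reach_of_con {ρ : Con G.Inv} {e g : E} (hv : ¬ ρ (G.vert (G.s e)) 0)
    (h : ρ (G.vert (G.s e)) (G.edge e * G.star e)) (hs : G.s g = G.s e) (hne : g ≠ e) :
    ¬ G.Reach (G.r g) (G.r e) := by
  rintro ⟨l, hl⟩
  exact hv (ρ.trans h (con_edge_mul_star_zero (con_zero_of_isPath hl (con_range_zero h hs hne))))

theorem forks_of_con {ρ σ : Con G.Inv} {e f : E} (hef : e ≠ f) (hs : G.s e = G.s f)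
    (hρ : ¬ ρ (G.vert (G.s e)) 0) (hρe : ρ (G.vert (G.s e)) (G.edge e * G.star e))
    (hσ : ¬ σ (G.vert (G.s f)) 0) (hσf : σ (G.vert (G.s f)) (G.edge f * G.star f)) :
    G.Forks e f :=
  ⟨hef, hs, fun _ hg hne => not_reach_of_con hρ hρe hg hne,
    fun _ hg hne => not_reach_of_con hσ hσf (hg.trans hs) hne⟩

/-! ### Distributivity on zero pairs and edge pairs -/

section Distributivity

variable {a b c d : Con G.Inv}

theorem inf_le_of_eq_or (ha : a ⊓ c ≤ d) (hb : b ⊓ c ≤ d) {c' : Con G.Inv}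
    (h : c' = a ∨ c' = b) {x y : G.Inv} (h1 : c' x y) (h2 : c x y) : d x y := by
  rcases h with rfl | rfl
  · exact ha (Con.inf_iff_and.2 ⟨h1, h2⟩)
  · exact hb (Con.inf_iff_and.2 ⟨h1, h2⟩)

/-- Since c kills v and all that is reachable from it, every relation in the derivation of the
kernel also lies in c. No assumption on forks is needed. -/
theorem JoinKernel.inf_zero (ha : a ⊓ c ≤ d) (hb : b ⊓ c ≤ d) {v : V} (h : JoinKernel a b v)
    (hv : c (G.vert v) 0) : d (G.vert v) 0 := by
  induction h with
  | zero c' hc' h => exact inf_le_of_eq_or ha hb hc' h hv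
  | step e c' hc' h hr ih =>
    have hr0 := con_zero_of_isPath (IsPath.singleton e) hv
    exact d.trans (inf_le_of_eq_or ha hb hc' h (con_edge_mul_star_of_zero hv))
      (con_edge_mul_star_zero (ih hr0))

theorem inf_edge_idem (hG : ∀ e f, ¬ G.Forks e f) (ha : a ⊓ c ≤ d) (hb : b ⊓ c ≤ d) {e : E}
    (h : (a ⊔ b) (G.vert (G.s e)) (G.edge e * G.star e))
    (he : c (G.vert (G.s e)) (G.edge e * G.star e)) :
    d (G.vert (G.s e)) (G.edge e * G.star e) := by
  by_cases hK : JoinKernel a b (G.s e)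
  · by_cases hc : c (G.vert (G.s e)) 0
    · exact con_edge_mul_star_of_zero (hK.inf_zero ha hb hc)
    generalize hv : G.s e = v at hK
    cases hK with
    | zero c' hc' h0 =>
      subst hv
      exact inf_le_of_eq_or ha hb hc' (con_edge_mul_star_of_zero h0) he
    | step f c' hc' hf hr =>
      by_cases hef : e = f
      · subst hef
        exact inf_le_of_eq_or ha hb hc' hf he
      by_cases h0 : c' (G.vert (G.s f)) 0
      · rw [← hv] at h0 ⊢
        exact inf_le_of_eq_or ha hb hc' (con_edge_mul_star_of_zero h0) he
      · exact absurd (forks_of_con hef hv hc he h0 hf) (hG e f)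
  · rcases exists_edge_idem_of_chain hK (con_sup_chain h) with h1 | ⟨c', hc', f, hfs, hf⟩
    · rw [h1]
      exact d.refl _
    · by_cases hef : e = f
      · subst hef
        exact inf_le_of_eq_or ha hb hc' hf he
      · rw [← hfs] at hf
        -- If e ≠ f, the relation s(e) ~ ff* sends r(e) to zero, hence s(e) ~ ee* ~ 0 in the join,
        -- although s(e) is outside the kernel.
        have h1 := le_sup_of_eq_or hc' (con_range_zero hf hfs.symm hef)
        exact absurd (JoinKernel.of_sup ((a ⊔ b).trans h (con_edge_mul_star_zero h1))) hK

theorem con_closed_rotate {ρ : Con G.Inv} {e : E} {l : List E}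
    (hl : G.IsPath (G.r e) l (G.s e)) (h : ρ (G.vert (G.s e)) (G.path (G.s e) (e :: l))) :
    ρ (G.vert (G.s e)) (G.edge e * G.star e) ∧
      ρ (G.vert (G.r e)) (G.path (G.r e) (l ++ [e])) := by
  constructor
  · refine con_edge_idem_of_mul_eq h ?_
    rw [path_cons, ← mul_assoc, mul_assoc (G.edge e), star_mul_edge_self, edge_mul_range]
  · have := con_mul_right (G.edge e) (con_mul_left (G.star e) h)
    rw [star_mul_source, star_mul_edge_self, path_cons, ← mul_assoc, star_mul_edge_self,
      hl.vert_mul_path] at this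
    rw [hl.path_append (IsPath.singleton e), path_cons, path_nil, edge_mul_range]
    exact this

/-- Without forks the derivation of the kernel can only follow the edges of the closed path, which
is rotated at each step. It ends at a vertex that is zero in a or b, and the rest of the cycle
carries this back to v. -/
theorem JoinKernel.zero_of_closed (hG : ∀ e f, ¬ G.Forks e f) {v : V} (h : JoinKernel a b v)
    (hv : ¬ c (G.vert v) 0) {l : List E} (hl : G.IsPath v l v) (hne : l ≠ [])
    (hc : c (G.vert v) (G.path v l)) : ∃ c', (c' = a ∨ c' = b) ∧ c' (G.vert v) 0 := by
  induction h generalizing l with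
  | zero c' hc' h => exact ⟨c', hc', h⟩
  | step f c' hc' hf hr ih =>
    by_cases h0 : c' (G.vert (G.s f)) 0
    · exact ⟨c', hc', h0⟩
    cases l with
    | nil => exact absurd rfl hne
    | cons e l =>
      obtain ⟨hs, hl⟩ := hl
      rw [← hs] at hl hv hc
      obtain ⟨he, hrot⟩ := con_closed_rotate hl hc
      by_cases hef : e = f
      · subst hef
        have hre : ¬ c (G.vert (G.r e)) 0 := fun h => hv (con_zero_of_isPath hl h)
        obtain ⟨c'', hc'', h⟩ := ih hre (hl.append (IsPath.singleton e)) (by simp) hrot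
        exact ⟨c'', hc'', con_zero_of_isPath hl h⟩
      · exact absurd (forks_of_con hef hs hv he h0 hf) (hG e f)

end Distributivity

/-! ### Closed paths identified with their base vertex, and their lengths -/

section ClosedPaths

variable {ρ : Con G.Inv} {v : V}

theorem exists_long_closed {p : List E} (hp : G.IsPath v p v) (hne : p ≠ [])
    (h : ρ (G.vert v) (G.path v p)) (n : ℕ) :
    ∃ q, G.IsPath v q v ∧ ρ (G.vert v) (G.path v q) ∧ n ≤ q.length := by
  induction n with
  | zero => exact ⟨p, hp, h, Nat.zero_le _⟩
  | succ n ih =>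
    obtain ⟨q, hq, h', hn⟩ := ih
    refine ⟨p ++ q, hp.append hq, ?_, ?_⟩
    · rw [hp.path_append hq]
      have := ρ.mul h h'
      rwa [vert_mul_self] at this
    · have := List.length_pos_of_ne_nil hne
      rw [List.length_append]
      omega

/-- If `ρ` identifies `v` with a closed path `p`, every path from `v` that avoids the zero class
runs around `p`. -/
theorem exists_append_of_length_le {p q : List E} {w : V} (hp : G.IsPath v p v)
    (h : ρ (G.vert v) (G.path v p)) (hq : G.IsPath v q w) (hw : ¬ ρ (G.vert w) 0)
    (hle : q.length ≤ p.length) : ∃ k, p = q ++ k ∧ G.IsPath w k v := by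
  rcases copath_mul_path_eq_zero_or hq hp with h0 | ⟨-, h1 | ⟨k, rfl, hk⟩⟩
  · have := con_mul_right (G.path v q) (con_mul_left (G.copath v q) h)
    rw [h0, zero_mul, hq.copath_mul_vert, hq.copath_mul_path] at this
    exact absurd this hw
  · exact h1
  · rw [List.length_append] at hle
    obtain rfl : k = [] := List.length_eq_zero_iff.1 (by omega)
    cases hk
    exact ⟨[], by simp, rfl⟩

variable {p : List E} (hp : G.IsPath v p v) (hne : p ≠ []) (h : ρ (G.vert v) (G.path v p))
  (hv : ¬ ρ (G.vert v) 0)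

include hp hne h hv in
-- Both paths are initial segments of one sufficiently high power of p.
theorem exists_append_of_closed {q r : List E} (hq : G.IsPath v q v) (hr : G.IsPath v r v)
    (hle : q.length ≤ r.length) : ∃ k, r = q ++ k ∧ G.IsPath v k v := by
  obtain ⟨P, hP, hρ, hlen⟩ := exists_long_closed hp hne h r.length
  obtain ⟨k, rfl, hk⟩ := exists_append_of_length_le hP hρ hr hv hlen
  obtain ⟨j, hj, hj'⟩ := exists_append_of_length_le hP hρ hq hv (hle.trans hlen)
  obtain ⟨i, rfl⟩ : q <+: r :=
    List.prefix_of_prefix_length_le ⟨j, hj.symm⟩ ⟨k, rfl⟩ hle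
  refine ⟨i, rfl, ?_⟩
  have key : ∀ {x y z : V} {l m : List E}, G.IsPath x l y → G.IsPath x (l ++ m) z →
      G.IsPath y m z := by
    intro x y z l m hl hm
    induction l generalizing x with
    | nil => cases hl; exact hm
    | cons e l ih => exact ih hl.2 hm.2
  exact key hq hr

include hp hne h hv in
theorem eq_of_closed_of_length_eq {q r : List E} (hq : G.IsPath v q v) (hr : G.IsPath v r v)
    (hlen : q.length = r.length) : q = r := by
  obtain ⟨k, rfl, -⟩ := exists_append_of_closed hp hne h hv hq hr hlen.le
  rw [List.length_append] at hlen
  obtain rfl : k = [] := List.length_eq_zero_iff.1 (by omega)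
  simp

/-- The integers `n` such that `c` identifies `v` with a closed path of length `|n|`. -/
def closedLengths (c : Con G.Inv) (v : V) : Set ℤ :=
  {n | ∃ q, G.IsPath v q v ∧ c (G.vert v) (G.path v q) ∧ q.length = n.natAbs}

theorem neg_mem_closedLengths {c : Con G.Inv} {n : ℤ} (hn : n ∈ closedLengths c v) :
    -n ∈ closedLengths c v := by
  obtain ⟨q, h1, h2, h3⟩ := hn
  exact ⟨q, h1, h2, by rw [h3, Int.natAbs_neg]⟩

include hp hne h hv in
theorem sub_mem_closedLengths_of_le {c : Con G.Inv} {q r : List E} (hq : G.IsPath v q v)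
    (hr : G.IsPath v r v) (hc : c (G.path v q) (G.path v r)) (hle : q.length ≤ r.length) :
    (r.length - q.length : ℤ) ∈ closedLengths c v := by
  obtain ⟨k, rfl, hk⟩ := exists_append_of_closed hp hne h hv hq hr hle
  refine ⟨k, hk, ?_, by simp⟩
  have := con_mul_left (G.copath v q) hc
  rwa [hq.path_append hk, ← mul_assoc, hq.copath_mul_path, hk.vert_mul_path] at this

include hp hne h hv in
theorem sub_mem_closedLengths {c : Con G.Inv} {q r : List E} (hq : G.IsPath v q v)
    (hr : G.IsPath v r v) (hc : c (G.path v q) (G.path v r)) :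
    (r.length - q.length : ℤ) ∈ closedLengths c v := by
  rcases le_total q.length r.length with hle | hle
  · exact sub_mem_closedLengths_of_le hp hne h hv hq hr hc hle
  · have := neg_mem_closedLengths
      (sub_mem_closedLengths_of_le hp hne h hv hr hq (c.symm hc) hle)
    rwa [neg_sub] at this

include hp hne h hv in
theorem add_mem_closedLengths {c : Con G.Inv} {m n : ℤ} (hm : m ∈ closedLengths c v)
    (hn : n ∈ closedLengths c v) : m + n ∈ closedLengths c v := by
  obtain ⟨q, hq, hcq, hql⟩ := hm
  obtain ⟨r, hr, hcr, hrl⟩ := hn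
  have h1 : (q.length + r.length : ℤ) ∈ closedLengths c v := by
    refine ⟨q ++ r, hq.append hr, ?_, by rw [List.length_append]; omega⟩
    have := c.mul hcq hcr
    rwa [vert_mul_self, ← hq.path_append hr] at this
  have h2 := sub_mem_closedLengths hp hne h hv hq hr (c.trans (c.symm hcq) hcr)
  have h3 := neg_mem_closedLengths h1
  have h4 := neg_mem_closedLengths h2
  rcases Int.natAbs_eq m with hm' | hm' <;> rcases Int.natAbs_eq n with hn' | hn' <;>
    rw [← hql] at hm' <;> rw [← hrl] at hn' <;> rw [hm', hn']
  · exact h1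
  · convert h4 using 1; ring
  · convert h2 using 1; ring
  · convert h3 using 1; ring

/-- The lengths of closed paths at `v` identified with `v` by `c`, as a subgroup of `ℤ`. -/
def closedLengthsSubgroup (c : Con G.Inv) : AddSubgroup ℤ where
  carrier := closedLengths c v
  add_mem' := add_mem_closedLengths hp hne h hv
  zero_mem' := ⟨[], rfl, c.refl _, rfl⟩
  neg_mem' := neg_mem_closedLengths

end ClosedPaths

/-- This is distributivity of the subgroups of ℤ in elementary form. With g = gcd(x, y), x = gx', y
= gy' and x's + y't = 1, take m = (x + y)x's and n = (x + y)y't; since g divides x + y, x divides m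
and y divides n. -/
theorem exists_add_eq_of_dvd (x y : ℤ) :
    ∃ m n : ℤ, m + n = x + y ∧ x ∣ m ∧ y ∣ n ∧ (x + y) ∣ m ∧ (x + y) ∣ n := by
  obtain ⟨x', hx⟩ := gcd_dvd_left x y
  obtain ⟨y', hy⟩ := gcd_dvd_right x y
  obtain ⟨k, hk⟩ := dvd_add (gcd_dvd_left x y) (gcd_dvd_right x y)
  by_cases hg : gcd x y = 0
  · rw [hg] at hx hy
    exact ⟨0, 0, by simp_all, by simp⟩
  have hb : gcd x y = x * x.gcdA y + y * x.gcdB y := by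
    rw [← Int.gcd_eq_gcd_ab, Int.coe_gcd]
  generalize x.gcdA y = s at hb
  generalize x.gcdB y = t at hb
  generalize gcd x y = g at *
  have h1 : x' * s + y' * t = 1 := by
    apply mul_left_cancel₀ hg
    subst hx
    calc g * (x' * s + y' * t) = g * x' * s + g * y' * t := by ring
      _ = g * 1 := by rw [← hy, ← hb, mul_one]
  refine ⟨(x + y) * (x' * s), (x + y) * (y' * t), ?_, ?_, ?_, dvd_mul_right _ _, dvd_mul_right _ _⟩
  · rw [← mul_add, h1, mul_one]
  · exact ⟨k * s, by rw [hk, hx]; ring⟩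
  · exact ⟨k * t, by rw [hk, hy]; ring⟩

end Joins

/-! ### Distributivity on closed-path pairs -/

section DistributivityOfJoin

variable {V : Type u} {E : Type v} {G : DirectedGraph V E} {a b c d : Con G.Inv}

theorem length_mem_closedLengths_sup {v : V} {p : List E} (hp : G.IsPath v p v) (hne : p ≠ [])
    (h : (a ⊔ b) (G.vert v) (G.path v p)) (hv : ¬ (a ⊔ b) (G.vert v) 0) :
    ∃ m ∈ closedLengths a v, ∃ n ∈ closedLengths b v, m + n = (p.length : ℤ) := by
  let A := closedLengthsSubgroup hp hne h hv a
  let B := closedLengthsSubgroup hp hne h hv b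
  -- An element αβ* on the chain is given the degree |α| − |β|. Each link changes it by an element
  -- of A or of B, so the degree |p| of the last element lies in A ⊔ B.
  have hle : ∀ {c : Con G.Inv}, (c = a ∨ c = b) → closedLengths c v ⊆ (A ⊔ B : AddSubgroup ℤ) := by
    rintro c (rfl | rfl)
    · exact fun x hx => AddSubgroup.mem_sup_left (S := A) hx
    · exact fun x hx => AddSubgroup.mem_sup_right (T := B) hx
  have key : ∀ x, Relation.ReflTransGen (fun x y => ∃ c, (c = a ∨ c = b) ∧ c x y) (G.vert v) x →
      (a ⊔ b) (G.vert v) x ∧ ∀ l m w, G.IsPath v l w → G.IsPath v m w →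
        x = G.path v l * G.copath v m → (l.length - m.length : ℤ) ∈ A ⊔ B := by
    -- one link of the chain, read off after multiplication by a long closed path
    have link : ∀ {c l m w l' m' w'}, (c = a ∨ c = b) → G.IsPath v l w → G.IsPath v m w →
        G.IsPath v l' w' → G.IsPath v m' w' →
        (a ⊔ b) (G.vert v) (G.path v l * G.copath v m) →
        c (G.path v l * G.copath v m) (G.path v l' * G.copath v m') →
        ((l'.length - m'.length : ℤ) - (l.length - m.length)) ∈ A ⊔ B := by
      intro c l m w l' m' w' hc hl hm hl' hm' hρ hlink
      have hw : ¬ (a ⊔ b) (G.vert w) 0 := fun h0 =>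
        hv ((a ⊔ b).trans hρ (con_path_mul_copath_zero hl h0))
      have hw' : ¬ (a ⊔ b) (G.vert w') 0 := fun h0 =>
        hv ((a ⊔ b).trans hρ ((a ⊔ b).trans (le_sup_of_eq_or hc hlink)
          (con_path_mul_copath_zero hl' h0)))
      -- P is long enough to begin with both m and m'; multiplying by it cancels the inverse paths
      -- and leaves two closed paths at v.
      obtain ⟨P, hP, hPρ, hlen⟩ := exists_long_closed hp hne h (m.length + m'.length)
      obtain ⟨k, hk, hkp⟩ := exists_append_of_length_le hP hPρ hm hw (by omega)
      obtain ⟨k', hk', hkp'⟩ := exists_append_of_length_le hP hPρ hm' hw' (by omega)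
      have h1 := con_mul_right (G.path v P) hlink
      nth_rewrite 1 [hk] at h1
      rw [hk', hm.path_append hkp, hm'.path_append hkp', mul_assoc, mul_assoc,
        ← mul_assoc (G.copath v m), ← mul_assoc (G.copath v m'), hm.copath_mul_path,
        hm'.copath_mul_path, hkp.vert_mul_path, hkp'.vert_mul_path, ← hl.path_append hkp,
        ← hl'.path_append hkp'] at h1
      have h2 := hle hc (sub_mem_closedLengths hp hne h hv (hl.append hkp) (hl'.append hkp') h1)
      have h3 := congrArg List.length (hk.symm.trans hk')
      simp only [List.length_append] at h2 h3
      have h4 : (l'.length - m'.length : ℤ) - (l.length - m.length) =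
          ((l'.length + k'.length : ℕ) : ℤ) - ((l.length + k.length : ℕ) : ℤ) := by omega
      rw [h4]
      exact h2
    intro x hx
    induction hx with
    | refl =>
      refine ⟨(a ⊔ b).refl _, fun l m w hl hm hx => ?_⟩
      have hx' : G.vert v = G.path v [] * G.copath v [] := (vert_mul_self v).symm
      have hc : a (G.path v [] * G.copath v []) (G.path v l * G.copath v m) := by
        rw [← hx', ← hx]
        exact a.refl _
      have hρ : (a ⊔ b) (G.vert v) (G.path v [] * G.copath v []) := by
        rw [← hx']
        exact (a ⊔ b).refl _
      have hnil : G.IsPath v [] v := rfl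
      simpa using link (Or.inl rfl) hnil hnil hl hm hρ hc
    | tail _ hxy ih =>
      obtain ⟨c, hc, hxy⟩ := hxy
      obtain ⟨hρ, ih⟩ := ih
      refine ⟨(a ⊔ b).trans hρ (le_sup_of_eq_or hc hxy), fun l m w hl hm hy => ?_⟩
      rcases con_vert_cases hρ with h0 | ⟨l', m', w', hl', hm', rfl⟩
      · exact absurd h0 hv
      · subst hy
        have := add_mem (link hc hl' hm' hl hm hρ hxy) (ih l' m' w' hl' hm' rfl)
        simpa using this
  have := (key _ (con_sup_chain h)).2 p [] v hp rfl (hp.path_mul_vert).symm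
  rw [List.length_nil, Nat.cast_zero, sub_zero] at this
  obtain ⟨m, hm, n, hn, hmn⟩ := AddSubgroup.mem_sup.1 this
  exact ⟨m, hm, n, hn, hmn⟩

theorem inf_closed_path (hG : ∀ e f, ¬ G.Forks e f) (ha : a ⊓ c ≤ d) (hb : b ⊓ c ≤ d)
    {v : V} {p : List E} (hp : G.IsPath v p v) (h : (a ⊔ b) (G.vert v) (G.path v p))
    (hc : c (G.vert v) (G.path v p)) : d (G.vert v) (G.path v p) := by
  by_cases hne : p = []
  · subst hne
    exact d.refl _
  by_cases hK : JoinKernel a b v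
  · by_cases hcv : c (G.vert v) 0
    · exact con_path_of_zero hp (hK.inf_zero ha hb hcv)
    · obtain ⟨c', hc', h0⟩ := hK.zero_of_closed hG hcv hp hne hc
      exact inf_le_of_eq_or ha hb hc' (con_path_of_zero hp h0) hc
  · have hv : ¬ (a ⊔ b) (G.vert v) 0 := fun h0 => hK (JoinKernel.of_sup h0)
    obtain ⟨x, hx, y, hy, hxy⟩ := length_mem_closedLengths_sup hp hne h hv
    -- The summands x and y need not be lengths for c; m and n are, being multiples of |p| = x + y.
    obtain ⟨m, n, hmn, hxm, hyn, hm, hn⟩ := exists_add_eq_of_dvd x y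
    have hdvd : ∀ (c : Con G.Inv) {x m : ℤ}, x ∈ closedLengths c v → x ∣ m →
        m ∈ closedLengths c v := by
      rintro c x _ hx ⟨k, rfl⟩
      have := (closedLengthsSubgroup hp hne h hv c).zsmul_mem hx k
      rwa [smul_eq_mul, mul_comm] at this
    have hp' : x + y ∈ closedLengths c v := ⟨p, hp, hc, by rw [hxy]; simp⟩
    have hinf : ∀ {c' : Con G.Inv} {m : ℤ}, (c' = a ∨ c' = b) → m ∈ closedLengths c' v →
        m ∈ closedLengths c v → m ∈ closedLengths d v := by
      rintro c' m hc' ⟨q, hq, h1, hql⟩ ⟨r, hr, h2, hrl⟩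
      obtain rfl := eq_of_closed_of_length_eq hp hne h hv hq hr (hql.trans hrl.symm)
      exact ⟨q, hq, inf_le_of_eq_or ha hb hc' h1 h2, hql⟩
    obtain ⟨q, hq, hqd, hql⟩ := add_mem_closedLengths hp hne h hv
      (hinf (Or.inl rfl) (hdvd a hx hxm) (hdvd c hp' hm))
      (hinf (Or.inr rfl) (hdvd b hy hyn) (hdvd c hp' hn))
    rw [hmn, hxy, Int.natAbs_natCast] at hql
    rwa [← eq_of_closed_of_length_eq hp hne h hv hq hp hql]

/-- Without forks, the congruence lattice is distributive. -/
theorem sup_inf_eq_of_not_forks (hG : ∀ e f, ¬ G.Forks e f) (a b c : Con G.Inv) :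
    (a ⊔ b) ⊓ c = (a ⊓ c) ⊔ (b ⊓ c) := by
  refine le_antisymm ?_ (sup_le (inf_le_inf_right c le_sup_left) (inf_le_inf_right c le_sup_right))
  refine con_of_basic_pairs (fun v hv => ?_) (fun e he => ?_) fun v l hl hvl => ?_
  · exact (JoinKernel.of_sup (Con.inf_iff_and.1 hv).1).inf_zero le_sup_left le_sup_right
      (Con.inf_iff_and.1 hv).2
  · exact inf_edge_idem hG le_sup_left le_sup_right (Con.inf_iff_and.1 he).1
      (Con.inf_iff_and.1 he).2
  · exact inf_closed_path hG le_sup_left le_sup_right hl (Con.inf_iff_and.1 hvl).1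
      (Con.inf_iff_and.1 hvl).2

end DistributivityOfJoin

/-! ### A representation by partial maps, used to show that elements stay distinct -/

section Representation

/-- Partial self-maps of a type, with composition of partial maps as multiplication. -/
def PartialMap (X : Type*) : Type _ := X → Option X

instance (X : Type*) : SemigroupWithZero (PartialMap X) where
  mul f g := fun x => (g x).bind f
  mul_assoc f g h := funext fun x => by
    change (h x).bind (fun y => (g y).bind f) = ((h x).bind g).bind f
    exact (Option.bind_assoc (h x) g f).symm
  zero := fun _ => none
  zero_mul f := funext fun x => by
    change (f x).bind (fun _ => none) = none
    cases f x <;> rfl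
  mul_zero _ := rfl

variable {V : Type u} {E : Type v} (G : DirectedGraph V E)

open Classical in
/-- The action of the generators on pairs of a vertex and a list of edges: edges are prepended,
their inverses remove the first edge. -/
noncomputable def genAct : Gen V E → V × List E → Option (V × List E)
  | .vertex x => fun p => if p.1 = x then some p else none
  | .edge e => fun p => if p.1 = G.r e then some (G.s e, e :: p.2) else none
  | .star e => fun p => match p.2 with
    | [] => none
    | f :: l => if p.1 = G.s e ∧ f = e then some (G.r e, l) else none

/-- The action of words on pairs of a vertex and a list of edges. -/
noncomputable def wordAct : Word V E →ₙ* PartialMap (V × List E) where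
  toFun w := WithZero.recZeroCoe 0 (FreeSemigroup.lift (β := PartialMap (V × List E)) G.genAct) w
  map_mul' x y := by
    induction x using WithZero.recZeroCoe with
    | zero => rw [zero_mul]; exact (zero_mul _).symm
    | coe x =>
      induction y using WithZero.recZeroCoe with
      | zero => rw [mul_zero]; exact (mul_zero _).symm
      | coe y => exact map_mul (FreeSemigroup.lift (β := PartialMap (V × List E)) G.genAct) x y

variable {G}

theorem wordAct_eq_of_rel {x y : Word V E} (h : G.Rel x y) : G.wordAct x = G.wordAct y := by
  cases h with
  | vertex_mul_self x =>
    funext p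
    change (G.genAct (.vertex x) p).bind (G.genAct (.vertex x)) = G.genAct (.vertex x) p
    by_cases hp : p.1 = x <;> simp [genAct, hp]
  | vertex_mul_of_ne x y h =>
    funext p
    change (G.genAct (.vertex y) p).bind (G.genAct (.vertex x)) = none
    by_cases hp : p.1 = y
    · simp [genAct, hp, h.symm]
    · simp [genAct, hp]
  | source_mul_edge e =>
    funext p
    change (G.genAct (.edge e) p).bind (G.genAct (.vertex (G.s e))) = G.genAct (.edge e) p
    by_cases hp : p.1 = G.r e <;> simp [genAct, hp]
  | edge_mul_range e =>
    funext p
    change (G.genAct (.vertex (G.r e)) p).bind (G.genAct (.edge e)) = G.genAct (.edge e) p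
    by_cases hp : p.1 = G.r e <;> simp [genAct, hp]
  | range_mul_star e =>
    funext p
    change (G.genAct (.star e) p).bind (G.genAct (.vertex (G.r e))) = G.genAct (.star e) p
    rcases p with ⟨x, _ | ⟨f, l⟩⟩
    · rfl
    · by_cases hp : x = G.s e ∧ f = e <;> simp [genAct, hp]
  | star_mul_source e =>
    funext p
    change (G.genAct (.vertex (G.s e)) p).bind (G.genAct (.star e)) = G.genAct (.star e) p
    rcases p with ⟨x, _ | ⟨f, l⟩⟩
    · by_cases hp : x = G.s e <;> simp [genAct, hp]
    · by_cases hp : x = G.s e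
      · subst hp
        simp [genAct]
      · simp [genAct, hp]
  | star_mul_edge_self e =>
    funext p
    change (G.genAct (.edge e) p).bind (G.genAct (.star e)) = G.genAct (.vertex (G.r e)) p
    rcases p with ⟨x, l⟩
    by_cases hp : x = G.r e <;> simp [genAct, hp]
  | star_mul_edge_of_ne f e h =>
    funext p
    change (G.genAct (.edge e) p).bind (G.genAct (.star f)) = none
    by_cases hp : p.1 = G.r e
    · simp [genAct, hp, h.symm]
    · simp [genAct, hp]

variable (G) in
/-- The action of the graph inverse semigroup on pairs of a vertex and a list of edges. -/
noncomputable def act (x : G.Inv) : V × List E → Option (V × List E) :=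
  Con.liftOn (c := conGen G.Rel) x G.wordAct fun a b h => by
    have hle : conGen G.Rel ≤ Con.ker G.wordAct :=
      Con.conGen_le.2 fun _ _ h => wordAct_eq_of_rel h
    exact hle h

theorem act_mul (x y : G.Inv) (p : V × List E) :
    G.act (x * y) p = (G.act y p).bind (G.act x) := by
  induction x using Con.induction_on with | H x => ?_
  induction y using Con.induction_on with | H y => ?_
  exact congrFun (map_mul G.wordAct x y) p

theorem act_zero (p : V × List E) : G.act 0 p = none := rfl

theorem act_gen (g : Gen V E) (p : V × List E) : G.act (G.gen g) p = G.genAct g p := rfl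

theorem act_isPath (x : G.Inv) {p q : V × List E} {t : V} (hp : G.IsPath p.1 p.2 t)
    (h : G.act x p = some q) : G.IsPath q.1 q.2 t := by
  have hgen : ∀ (g : Gen V E) {p q : V × List E}, G.IsPath p.1 p.2 t →
      G.genAct g p = some q → G.IsPath q.1 q.2 t := by
    rintro g ⟨x, l⟩ q hp h
    cases g with
    | vertex y =>
      simp only [genAct, Option.ite_none_right_eq_some, Option.some.injEq] at h
      rw [← h.2]
      exact hp
    | edge e =>
      simp only [genAct, Option.ite_none_right_eq_some, Option.some.injEq] at h
      rw [← h.2]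
      obtain ⟨rfl, -⟩ := h
      exact ⟨rfl, hp⟩
    | star e =>
      cases l with
      | nil => cases h
      | cons f l =>
        simp only [genAct, Option.ite_none_right_eq_some, Option.some.injEq] at h
        obtain ⟨⟨rfl, rfl⟩, rfl⟩ := h
        exact hp.2
  induction x using Inv.induction generalizing q with
  | zero => cases h
  | of g => exact hgen g hp h
  | gen_mul g x ih =>
    rw [act_mul, Option.bind_eq_some_iff] at h
    obtain ⟨p', h1, h2⟩ := h
    exact hgen g (ih h1) h2

variable (G) in
/-- The congruence of acting in the same way on all paths that end in `t`. -/
def actCon (t : V) : Con G.Inv where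
  r x y := ∀ p : V × List E, G.IsPath p.1 p.2 t → G.act x p = G.act y p
  iseqv := ⟨fun _ _ _ => rfl, fun h p hp => (h p hp).symm,
    fun h h' p hp => (h p hp).trans (h' p hp)⟩
  mul' := by
    intro w x y z h h' p hp
    rw [act_mul, act_mul, h' p hp]
    cases hz : G.act z p with
    | none => rfl
    | some q => exact h q (act_isPath z hp hz)

theorem actCon_vert_zero_iff {t x : V} : G.actCon t (G.vert x) 0 ↔ ¬ G.Reach x t := by
  constructor
  · rintro h ⟨l, hl⟩
    have := h (x, l) hl
    rw [act_zero, act_gen] at this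
    simp [genAct] at this
  · rintro h ⟨y, l⟩ hp
    rw [act_zero, act_gen]
    have : y ≠ x := by
      rintro rfl
      exact h ⟨l, hp⟩
    simp [genAct, this]

/-- Removing and restoring the first edge e is the identity on paths that begin with e. -/
theorem actCon_edge_idem {t : V} {e : E} (h : ∀ l, G.IsPath (G.s e) l t → ∃ m, l = e :: m) :
    G.actCon t (G.vert (G.s e)) (G.edge e * G.star e) := by
  rintro ⟨y, l⟩ hp
  rw [act_mul, act_gen, act_gen]
  by_cases hy : y = G.s e
  · subst hy
    obtain ⟨m, rfl⟩ := h l hp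
    simp [genAct, act_gen]
  · cases l with
    | nil => simp [genAct, hy]
    | cons f l => simp [genAct, hy]

theorem vert_ne_edge_mul_star (e : E) : G.vert (G.s e) ≠ G.edge e * G.star e := by
  intro h
  have := congrArg (fun x => G.act x (G.s e, [])) h
  simp [act_mul, act_gen, genAct] at this

end Representation

/-! ### Forks violate lower semimodularity -/

section Forks

variable {V : Type u} {E : Type v} {G : DirectedGraph V E}

/-- Zorn's lemma, the union of a chain of congruences being a congruence. If j is the least
congruence above p that contains (x, y), the p found here is covered by j. -/
theorem exists_maximal_con_not {M : Type*} [Mul M] {a j : Con M} (haj : a ≤ j) {x y : M}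
    (h : ¬ a x y) : ∃ p, a ≤ p ∧ p ≤ j ∧ ¬ p x y ∧ ∀ q, p < q → q ≤ j → q x y := by
  obtain ⟨p, hap, hp, hmax⟩ := zorn_le_nonempty₀ {p : Con M | p ≤ j ∧ ¬ p x y} (by
    intro C hC hchain c₀ hc₀
    let U : Con M :=
      { r := fun x y => ∃ c ∈ C, c x y
        iseqv := by
          refine ⟨fun x => ⟨c₀, hc₀, c₀.refl x⟩, fun ⟨c, hc, h⟩ => ⟨c, hc, c.symm h⟩, ?_⟩
          rintro x y z ⟨c, hc, h⟩ ⟨c', hc', h'⟩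
          rcases hchain.total hc hc' with hle | hle
          · exact ⟨c', hc', c'.trans (hle h) h'⟩
          · exact ⟨c, hc, c.trans h (hle h')⟩
        mul' := by
          rintro w x y z ⟨c, hc, h⟩ ⟨c', hc', h'⟩
          rcases hchain.total hc hc' with hle | hle
          · exact ⟨c', hc', c'.mul (hle h) h'⟩
          · exact ⟨c, hc, c.mul h (hle h')⟩ }
    refine ⟨U, ⟨?_, ?_⟩, fun c hc x y h => ⟨c, hc, h⟩⟩
    · rintro x y ⟨c, hc, h⟩
      exact (hC hc).1 h
    · rintro ⟨c, hc, h⟩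
      exact (hC hc).2 h) a ⟨haj, h⟩
  refine ⟨p, hap, hp.1, hp.2, fun q hpq hqj => ?_⟩
  by_contra hq
  exact hpq.not_ge (hmax ⟨hqj, hq⟩ hpq.le)

variable (G) in
/-- The congruence that identifies all vertices reachable from `v` with zero. -/
def reachCon (v : V) : Con G.Inv :=
  conGen fun x y => ∃ u, G.Reach v u ∧ x = G.vert u ∧ y = 0

theorem reachCon_vert {v u : V} (h : G.Reach v u) : G.reachCon v (G.vert u) 0 :=
  ConGen.Rel.of _ _ ⟨u, h, rfl, rfl⟩

theorem con_range_zero_of_star_mul_zero {ρ : Con G.Inv} {e : E} (h : ρ (G.star e) 0) :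
    ρ (G.vert (G.r e)) 0 := by
  have := con_mul_right (G.edge e) h
  rwa [star_mul_edge_self, zero_mul] at this

/-- If `e` is the only edge at `s(e)` that leads towards `r(e)`, some congruence identifies `s(e)`
with `e e*`, and is covered by the congruence generated by collapsing everything below `s(e)`. -/
theorem exists_con_covBy_reachCon {e : E}
    (h : ∀ g, G.s g = G.s e → g ≠ e → ¬ G.Reach (G.r g) (G.r e))
    (hne : ¬ G.Reach (G.r e) (G.s e)) :
    ∃ p : Con G.Inv, (∀ u, G.Reach (G.s e) u → ¬ G.Reach u (G.r e) → p (G.vert u) 0) ∧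
      p (G.vert (G.s e)) (G.edge e * G.star e) ∧ ¬ p (G.vert (G.r e)) 0 ∧
      p ≤ G.reachCon (G.s e) ∧
      (∀ q, p ≤ q → q (G.vert (G.r e)) 0 → G.reachCon (G.s e) ≤ q) ∧
      p ⋖ G.reachCon (G.s e) := by
  let R : G.Inv → G.Inv → Prop := fun x y =>
    (∃ u, G.Reach (G.s e) u ∧ ¬ G.Reach u (G.r e) ∧ x = G.vert u ∧ y = 0) ∨
      (x = G.vert (G.s e) ∧ y = G.edge e * G.star e)
  have haj : conGen R ≤ G.reachCon (G.s e) := by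
    refine Con.conGen_le.2 ?_
    rintro x y (⟨u, hu, -, rfl, rfl⟩ | ⟨rfl, rfl⟩)
    · exact reachCon_vert hu
    · exact con_edge_mul_star_of_zero (reachCon_vert (Reach.refl _))
  -- The action on paths ending in r(e) respects R, because such a path starting at s(e) must begin
  -- with e; yet r(e) does not act as zero.
  have hact : conGen R ≤ G.actCon (G.r e) := by
    refine Con.conGen_le.2 ?_
    rintro x y (⟨u, -, hu, rfl, rfl⟩ | ⟨rfl, rfl⟩)
    · exact actCon_vert_zero_iff.2 hu
    · refine actCon_edge_idem fun l hl => ?_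
      cases l with
      | nil =>
        exact absurd ⟨[], Eq.symm hl⟩ hne
      | cons g l =>
        by_cases hge : g = e
        · exact ⟨l, by rw [hge]⟩
        · exact absurd ⟨l, hl.2⟩ (h g hl.1 hge)
  have hR : ¬ conGen R (G.vert (G.r e)) 0 := fun h0 =>
    actCon_vert_zero_iff.1 (hact h0) (Reach.refl _)
  obtain ⟨p, hap, hpj, hp, hmax⟩ := exists_maximal_con_not haj hR
  have h1 : ∀ u, G.Reach (G.s e) u → ¬ G.Reach u (G.r e) → p (G.vert u) 0 := fun u hu hu' =>
    hap (ConGen.Rel.of _ _ (Or.inl ⟨u, hu, hu', rfl, rfl⟩))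
  have h2 : p (G.vert (G.s e)) (G.edge e * G.star e) :=
    hap (ConGen.Rel.of _ _ (Or.inr ⟨rfl, rfl⟩))
  have h3 : ∀ q, p ≤ q → q (G.vert (G.r e)) 0 → G.reachCon (G.s e) ≤ q := by
    intro q hpq hq
    refine Con.conGen_le.2 ?_
    rintro x y ⟨u, ⟨l, hl⟩, rfl, rfl⟩
    exact con_zero_of_isPath hl (q.trans (hpq h2) (con_edge_mul_star_zero hq))
  refine ⟨p, h1, h2, hp, hpj, h3, ⟨lt_of_le_of_ne hpj ?_, fun q hpq hqj => ?_⟩⟩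
  · rintro rfl
    exact hp (reachCon_vert (Reach.edge e))
  · exact hqj.not_ge (h3 q hpq.le (hmax q hpq hqj.le))

/-- A congruence in which `r(e)` is not zero relates `s(e)` to no normal form that starts with an
edge other than `e`. -/
theorem head_eq_of_con {ρ : Con G.Inv} {e g : E} {z : G.Inv}
    (h0 : ¬ ρ (G.vert (G.r e)) 0) (hz : ρ (G.vert (G.s e)) (G.edge g * z)) : g = e := by
  by_contra hne
  have := con_mul_left (G.star e) hz
  rw [star_mul_source, ← mul_assoc, star_mul_edge_of_ne (Ne.symm hne), zero_mul] at this
  exact h0 (con_range_zero_of_star_mul_zero this)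

/-- A fork violates lower semimodularity. -/
theorem not_forks_of_isWeakLowerModularLattice [IsWeakLowerModularLattice (Con G.Inv)] (e f : E) :
    ¬ G.Forks e f := by
  rintro ⟨hef, hs, he, hf⟩
  -- An edge g with a way back to s(e) leads towards both r(e) and r(f), but it differs from e or
  -- from f.
  have hloop : ∀ g, G.s g = G.s e → ¬ G.Reach (G.r g) (G.s e) := by
    intro g hg hr
    by_cases hge : g = e
    · refine hf g hg (hge ▸ hef) (hr.trans ?_)
      rw [hs]
      exact Reach.edge f
    · exact he g hg hge (hr.trans (Reach.edge e))
  have hef' : ¬ G.Reach (G.r e) (G.r f) := hf e rfl hef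
  have hfe' : ¬ G.Reach (G.r f) (G.r e) := he f hs.symm hef.symm
  obtain ⟨p, hp1, hp2, hp3, hpj, hpq, hpc⟩ := exists_con_covBy_reachCon he (hloop e rfl)
  obtain ⟨q, hq1, hq2, hq3, hqj, hqp, hqc⟩ := exists_con_covBy_reachCon
    (fun g hg => hf g (hg.trans hs.symm)) (hs ▸ hloop f hs.symm)
  rw [← hs] at hq1 hq2 hqj hqp hqc
  have hpf : p (G.vert (G.r f)) 0 := hp1 _ (hs ▸ Reach.edge f) hfe'
  have hqe : q (G.vert (G.r e)) 0 := hq1 _ (Reach.edge e) hef'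
  have hsup : p ⊔ q = G.reachCon (G.s e) :=
    le_antisymm (sup_le hpj hqj) (hpq _ le_sup_left ((le_sup_right : q ≤ p ⊔ q) hqe))
  have hcov : p ⊓ q ⋖ p := by
    apply IsWeakLowerModularLattice.inf_covBy_of_covBy_covBy_sup
    · rwa [hsup]
    · rwa [hsup]
  -- the class of `s(e)` under `p ⊓ q` is a singleton
  have hsing : ∀ x, (p ⊓ q) (G.vert (G.s e)) x → x = G.vert (G.s e) := by
    intro x hx
    obtain ⟨hpx, hqx⟩ := Con.inf_iff_and.1 hx
    rcases con_vert_cases hpx with h0 | ⟨l, m, c, hl, hm, rfl⟩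
    · exact absurd (con_zero_of_isPath (IsPath.singleton e) h0) hp3
    cases l with
    | cons g l =>
      rw [path_cons, mul_assoc] at hpx hqx
      rw [hs] at hqx
      exact absurd ((head_eq_of_con hp3 hpx).symm.trans (head_eq_of_con hq3 hqx)) hef
    | nil =>
      cases m with
      | nil =>
        rw [path_nil, copath_nil, vert_mul_self]
      | cons g m =>
        cases id hl
        exact absurd ⟨m, hm.2⟩ (hloop g hm.1)
  -- `τ` lies below p but not below q, so (p ⊓ q) ⊔ τ is the candidate strictly between p ⊓ q and p.
  let τ : Con G.Inv := conGen fun x y => x = G.vert (G.r f) ∧ y = 0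
  have hτp : τ ≤ p := Con.conGen_le.2 (by rintro x y ⟨rfl, rfl⟩; exact hpf)
  have hτf : τ (G.vert (G.r f)) 0 := ConGen.Rel.of _ _ ⟨rfl, rfl⟩
  -- The Rees congruence of the ideal of elements that kill all paths ending in s(e). It contains
  -- `τ`, and s(e) lies outside the ideal because of the empty path.
  let κ : Con G.Inv :=
    { r := fun x y => x = y ∨ (G.actCon (G.s e) x 0 ∧ G.actCon (G.s e) y 0)
      iseqv := by
        refine ⟨fun _ => Or.inl rfl, fun h => h.imp Eq.symm And.symm, ?_⟩
        rintro x y z (rfl | h) (rfl | h')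
        · exact Or.inl rfl
        · exact Or.inr h'
        · exact Or.inr h
        · exact Or.inr ⟨h.1, h'.2⟩
      mul' := by
        have hl : ∀ z {x : G.Inv}, G.actCon (G.s e) x 0 → G.actCon (G.s e) (z * x) 0 := by
          intro z x h
          simpa using con_mul_left z h
        have hr : ∀ z {x : G.Inv}, G.actCon (G.s e) x 0 → G.actCon (G.s e) (x * z) 0 := by
          intro z x h
          simpa using con_mul_right z h
        rintro w x y z (rfl | h) (rfl | h')
        · exact Or.inl rfl
        · exact Or.inr ⟨hl _ h'.1, hl _ h'.2⟩
        · exact Or.inr ⟨hr _ h.1, hr _ h.2⟩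
        · exact Or.inr ⟨hr _ h.1, hr _ h.2⟩ }
  have hτκ : τ ≤ κ := Con.conGen_le.2 (by
    rintro x y ⟨rfl, rfl⟩
    exact Or.inr ⟨actCon_vert_zero_iff.2 (hloop f hs.symm), Con.refl _ _⟩)
  have hτsing : ∀ x, τ (G.vert (G.s e)) x → x = G.vert (G.s e) := by
    intro x hx
    rcases hτκ hx with h | h
    · exact h.symm
    · exact absurd (Reach.refl _) (actCon_vert_zero_iff.1 h.1)
  have hchain : ∀ x, ((p ⊓ q) ⊔ τ) (G.vert (G.s e)) x → x = G.vert (G.s e) := by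
    intro x hx
    have h := con_sup_chain hx
    clear hx
    induction h with
    | refl => rfl
    | tail _ h ih =>
      obtain ⟨c, hc, h⟩ := h
      rw [ih] at h
      rcases hc with rfl | rfl
      · exact hsing _ h
      · exact hτsing _ h
  rcases hcov.eq_or_eq le_sup_left (sup_le inf_le_left hτp : (p ⊓ q) ⊔ τ ≤ p) with h | h
  · have h1 : (p ⊓ q) (G.vert (G.r f)) 0 := by
      rw [← h]
      exact (le_sup_right : τ ≤ (p ⊓ q) ⊔ τ) hτf
    exact hq3 (Con.inf_iff_and.1 h1).2
  · rw [← h] at hp2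
    exact vert_ne_edge_mul_star e (hchain _ hp2).symm

end Forks

end DirectedGraph

/-- For every directed graph `G`, the congruence lattice of the graph inverse semigroup of `G` is
lower semimodular iff it is modular iff it is distributive. (Mathlib's
`IsWeakLowerModularLattice` is lower semimodularity: if `a ⊔ b` covers both `a` and `b`, then both
cover `a ⊓ b`. `Con G.Inv` is the lattice of all congruences on `G.Inv`, ordered by inclusion.) -/
theorem theorem1p1 {V : Type u} {E : Type v} (G : DirectedGraph V E) :
    List.TFAE
      [ IsWeakLowerModularLattice (Con G.Inv),
        IsModularLattice (Con G.Inv),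
        ∀ a b c : Con G.Inv, (a ⊔ b) ⊓ c = (a ⊓ c) ⊔ (b ⊓ c) ] := by
  tfae_have 1 → 3 := fun _ =>
    DirectedGraph.sup_inf_eq_of_not_forks DirectedGraph.not_forks_of_isWeakLowerModularLattice
  tfae_have 3 → 2 := fun h => ⟨fun {x} y {z} hxz => by rw [h, inf_eq_left.2 hxz]⟩
  tfae_have 2 → 1 := fun _ => inferInstance
  tfae_finish
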